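/- Let $k$ be a field of characteristic zero, let $n\ge 4$ and $d\ge 3$ be integers, and let $R=k[x_1,\dots,x_n]$ with the standard grading. Let $\mathrm{RLex}(x_1x_2^{d-1})$ be the ideal of $R$ generated by all monomials of degree $d$ that are greater than or equal to $x_1x_2^{d-1}$ in the reverse lexicographic order with $x_1>\cdots>x_n$ (for monomials of the same degree, $x^a>x^b$ if the last non-zero entry of $a-b$ is negative), and put \[ I=(x_1^d,\dots,x_n^d)+\mathrm{RLex}(x_1x_2^{d-1}). \] Then \[ I=(x_1,x_2)^d+(x_3^d,\dots,x_n^d), \] and the algebra $A=R/I$ does not have the weak Lefschetz property. That is, there is no linear form $\ell\in A_1$ such that for every $j\ge 0$ the multiplication map $\cdot\ell:A_j\to A_{j+1}$ has full rank, i.e. rank equal to $\min\{\dim_k A_j,\dim_k A_{j+1}\}$. -/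

import Mathlib

/-- For an ideal `I` of `R = k[x_1, …, x_n]`, the degree `j` part `A_j` of `A = R/I`:
the image in `A` of the homogeneous polynomials of degree `j`. -/
noncomputable def gradedPart {k : Type*} [Field k] {n : ℕ} (I : Ideal (MvPolynomial (Fin n) k))
    (j : ℕ) : Submodule k (MvPolynomial (Fin n) k ⧸ I) :=
  (MvPolynomial.homogeneousSubmodule (Fin n) k j).map (Ideal.Quotient.mkₐ k I).toLinearMap

theorem mul_mem_gradedPart {k : Type*} [Field k] {n : ℕ} (I : Ideal (MvPolynomial (Fin n) k))
    {i j : ℕ} {a b : MvPolynomial (Fin n) k ⧸ I} (ha : a ∈ gradedPart I i)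
    (hb : b ∈ gradedPart I j) : a * b ∈ gradedPart I (j + i) := by
  obtain ⟨p, hp, rfl⟩ := ha
  obtain ⟨q, hq, rfl⟩ := hb
  refine ⟨p * q, ?_, by simp⟩
  rw [add_comm]
  exact MvPolynomial.IsHomogeneous.mul hp hq

/-- Multiplication by `ℓ ∈ A_1`, as a `k`-linear map `A_j → A_{j+1}`. -/
noncomputable def mulLinearForm {k : Type*} [Field k] {n : ℕ}
    (I : Ideal (MvPolynomial (Fin n) k)) (l : gradedPart I 1) (j : ℕ) :
    gradedPart I j →ₗ[k] gradedPart I (j + 1) :=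
  (LinearMap.mulLeft k (l : MvPolynomial (Fin n) k ⧸ I)).restrict
    (fun _ hx => mul_mem_gradedPart I l.2 hx)

/-- A linear map between finite-dimensional vector spaces has full rank if its rank is the
minimum of the two dimensions. -/
def HasFullRank {k V W : Type*} [Field k] [AddCommGroup V] [Module k V] [AddCommGroup W]
    [Module k W] (f : V →ₗ[k] W) : Prop :=
  Module.finrank k (LinearMap.range f) = min (Module.finrank k V) (Module.finrank k W)

/-- The weak Lefschetz property of the standard graded algebra `A = k[x_1, …, x_n]/I`
(for a homogeneous ideal `I`): for some linear form `ℓ ∈ A_1`, all the maps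
`ℓ · : A_j → A_{j+1}`, `j ≥ 0`, have full rank. -/
def HasWLP {k : Type*} [Field k] {n : ℕ} (I : Ideal (MvPolynomial (Fin n) k)) : Prop :=
  ∃ l : gradedPart I 1, ∀ j : ℕ, HasFullRank (mulLinearForm I l j)

/-- The reverse lexicographic order with `x_1 > ⋯ > x_n` on monomials of the same degree, in terms
of exponent vectors: `x^a > x^b` if the last non-zero entry of `a - b` is negative. -/
def RevLexGT {n : ℕ} (a b : Fin n →₀ ℕ) : Prop :=
  a.degree = b.degree ∧ ∃ i : Fin n, a i < b i ∧ ∀ j : Fin n, i < j → a j = b j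

/-- `RLex(x^m)`: the ideal generated by all monomials of the same degree as `x^m` that are greater
than or equal to `x^m` in the reverse lexicographic order. -/
noncomputable def RLex (k : Type*) [Field k] {n : ℕ} (m : Fin n →₀ ℕ) :
    Ideal (MvPolynomial (Fin n) k) :=
  Ideal.span {f | ∃ a : Fin n →₀ ℕ, (a = m ∨ RevLexGT a m) ∧ f = MvPolynomial.monomial a 1}

/-! Put m = n - 2 and let B, C be the quotients by the d-th powers of the variables in m + 1 and m
variables; `boxCount` is their Hilbert function. Any linear form ℓ on A lies in a copy of B that is
a retract of A: merge the x₁, x₂ part of ℓ into one variable (`embedPair`, `collapsePair`). So where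
the Hilbert function of B drops, ℓ has a kernel on A. Collapsing x₁, x₂ instead along a direction
killed by ℓ maps A onto C[y]/(y^d) and ℓ to a form on C. Reading off the coefficient of y^(d-1),
surjectivity of ℓ on A_(e+d-1) would force surjectivity from C_e to C_(e+1), which is impossible
where the Hilbert function of C grows. Both Hilbert functions are symmetric and strictly unimodal,
and for d ≥ 3 some degree e + d - 1 is past the middle of B with e + 1 not past the middle of C. -/

/-! ### Symmetry and strict unimodality of box counts. -/

/-- The number of exponent vectors in the box `[0, d)^r` with coordinate sum `z`. -/
def boxCount (d r : ℕ) (z : ℤ) : ℕ :=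
  Fintype.card {a : Fin r → Fin d // ∑ i, ((a i : ℕ) : ℤ) = z}

theorem boxCount_zero (d : ℕ) (z : ℤ) : boxCount d 0 z = if z = 0 then 1 else 0 := by
  unfold boxCount
  rw [Fintype.card_subtype]
  split_ifs with h
  · simp [h]
  · simp [Ne.symm h]

theorem boxCount_succ (d r : ℕ) (z : ℤ) :
    boxCount d (r + 1) z = ∑ c ∈ Finset.range d, boxCount d r (z - c) := by
  rw [← Fin.sum_univ_eq_sum_range (fun c => boxCount d r (z - c)) d]
  unfold boxCount
  rw [← Fintype.card_sigma]
  refine Fintype.card_congr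
    { toFun := fun a => ⟨a.1 0, fun i => a.1 i.succ, ?_⟩
      invFun := fun b => ⟨Fin.cons b.1 b.2.1, ?_⟩
      left_inv := ?_
      right_inv := ?_ }
  · have := a.2
    rw [Fin.sum_univ_succ] at this
    linarith
  · have := b.2.2
    rw [Fin.sum_univ_succ]
    simp only [Fin.cons_zero, Fin.cons_succ]
    linarith
  · intro a
    ext i
    refine Fin.cases ?_ (fun i => ?_) i <;> simp
  · intro b
    rfl

theorem boxCount_symm (d r : ℕ) (z : ℤ) :
    boxCount d r (r * ((d : ℤ) - 1) - z) = boxCount d r z := by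
  unfold boxCount
  have key (a : Fin r → Fin d) :
      ∑ i, (((a i).rev : ℕ) : ℤ) = r * ((d : ℤ) - 1) - ∑ i, ((a i : ℕ) : ℤ) := by
    have (i : Fin r) : (((a i).rev : ℕ) : ℤ) = ((d : ℤ) - 1) - ((a i : ℕ) : ℤ) := by
      rw [Fin.val_rev]
      have := (a i).2
      omega
    rw [Finset.sum_congr rfl fun i _ => this i, Finset.sum_sub_distrib]
    simp [mul_sub]
  refine Fintype.card_congr
    { toFun := fun a => ⟨fun i => (a.1 i).rev, ?_⟩
      invFun := fun a => ⟨fun i => (a.1 i).rev, ?_⟩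
      left_inv := fun a => by simp
      right_inv := fun a => by simp }
  · rw [key, a.2]; ring
  · rw [key, a.2]

/-- Sliding a window of length d by one gains one term and loses one; the identity is kept additive
to avoid truncated subtraction. -/
theorem boxCount_succ_sub (d r : ℕ) (z : ℤ) :
    boxCount d (r + 1) z + boxCount d r (z - d) =
      boxCount d (r + 1) (z - 1) + boxCount d r z := by
  rw [boxCount_succ, boxCount_succ]
  have h1 := Finset.sum_range_succ (fun c : ℕ => boxCount d r (z - c)) d
  have h2 := Finset.sum_range_succ' (fun c : ℕ => boxCount d r (z - c)) d
  have h3 : ∀ c : ℕ, z - 1 - (c : ℤ) = z - ((c + 1 : ℕ) : ℤ) := fun c => by push_cast; ring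
  simp only [h3]
  simp only [Nat.cast_zero, sub_zero] at h2
  omega

theorem boxCount_one (d : ℕ) (z : ℤ) : boxCount d 1 z = if 0 ≤ z ∧ z < d then 1 else 0 := by
  rw [boxCount_succ]
  simp only [boxCount_zero, sub_eq_zero]
  split_ifs with h
  · lift z to ℕ using h.1
    simp [Finset.sum_ite_eq]
    omega
  · refine Finset.sum_eq_zero fun c hc => if_neg ?_
    have := Finset.mem_range.1 hc
    omega

/-- Below the middle degree of the box of dimension `r + 2`, the count for dimension `r + 1` strictly
increases along steps of size `d`. -/
theorem boxCount_lt_aux (d r : ℕ) (hd : 1 ≤ d) (b : ℤ) (hb : 0 ≤ b)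
    (h : 2 * b ≤ ((r : ℤ) + 2) * ((d : ℤ) - 1)) :
    boxCount d (r + 1) (b - d) < boxCount d (r + 1) b := by
  induction r generalizing b with
  | zero =>
    rw [boxCount_one, boxCount_one, if_neg (by omega), if_pos (by push_cast at h; omega)]
    exact one_pos
  | succ r ih =>
    -- The first difference in dimension r + 2 is a step of size d in dimension r + 1, which the
    -- induction hypothesis controls.
    have step (b : ℤ) (hb : 0 ≤ b) (h : 2 * b ≤ ((r : ℤ) + 2) * ((d : ℤ) - 1)) :
        boxCount d (r + 2) (b - 1) < boxCount d (r + 2) b := by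
      have h1 := ih b hb h
      have h2 : boxCount d (r + 2) b + _ = boxCount d (r + 2) (b - 1) + _ :=
        boxCount_succ_sub d (r + 1) b
      omega
    have neg (z : ℤ) (hz : z < 0) : boxCount d (r + 2) z = 0 := by
      unfold boxCount
      rw [Fintype.card_eq_zero_iff]
      refine ⟨fun a => ?_⟩
      have := a.2
      have : 0 ≤ ∑ i, ((a.1 i : ℕ) : ℤ) := Finset.sum_nonneg fun i _ => by positivity
      omega
    have mono (t : ℕ) : ∀ b : ℤ, 0 ≤ b → 2 * b ≤ ((r : ℤ) + 2) * ((d : ℤ) - 1) →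
        boxCount d (r + 2) (b - (t + 1 : ℕ)) < boxCount d (r + 2) b := by
      induction t with
      | zero => simpa using step
      | succ t iht =>
        intro b hb h
        rcases hb.eq_or_lt with rfl | hb'
        · rw [neg (0 - _) (by push_cast; omega)]
          exact (Nat.zero_le _).trans_lt (step 0 hb h)
        · have := iht (b - 1) (by omega) (by omega)
          rw [show b - 1 - ((t + 1 : ℕ) : ℤ) = b - ((t + 1 + 1 : ℕ) : ℤ) by push_cast; ring] at this
          exact this.trans (step b hb h)
    have strict {a b : ℤ} (hab : a < b) (hb : 0 ≤ b)
        (h : 2 * b ≤ ((r : ℤ) + 2) * ((d : ℤ) - 1)) :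
        boxCount d (r + 2) a < boxCount d (r + 2) b := by
      have := mono (b - a - 1).toNat b hb h
      rwa [show b - (((b - a - 1).toNat + 1 : ℕ) : ℤ) = a by omega] at this
    by_cases hc : 2 * b ≤ ((r : ℤ) + 2) * ((d : ℤ) - 1)
    · exact strict (by omega) hb hc
    -- Past the middle, reflect b; the bound on b keeps the mirror image above b - d.
    · have hs := boxCount_symm d (r + 2) b
      rw [← hs]
      push_cast at h hs ⊢
      have e : ((r : ℤ) + 1 + 2) * ((d : ℤ) - 1) = ((r : ℤ) + 2) * ((d : ℤ) - 1) + (d - 1) := by ring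
      have e' : ((r : ℤ) + 2) * ((d : ℤ) - 1) = (r : ℤ) * (d - 1) + 2 * (d - 1) := by ring
      have hr : 0 ≤ (r : ℤ) * ((d : ℤ) - 1) := mul_nonneg (by positivity) (by omega)
      refine strict ?_ ?_ ?_
      all_goals linarith

theorem boxCount_sub_one_lt (d r : ℕ) (hd : 1 ≤ d) (b : ℤ) (hb : 0 ≤ b)
    (h : 2 * b ≤ ((r : ℤ) + 2) * ((d : ℤ) - 1)) :
    boxCount d (r + 2) (b - 1) < boxCount d (r + 2) b := by
  have h1 := boxCount_lt_aux d r hd b hb h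
  have h2 : boxCount d (r + 2) b + _ = boxCount d (r + 2) (b - 1) + _ :=
    boxCount_succ_sub d (r + 1) b
  omega

theorem boxCount_add_one_lt (d r : ℕ) (hd : 1 ≤ d) (b : ℤ)
    (hb : b ≤ ((r : ℤ) + 2) * ((d : ℤ) - 1)) (h : ((r : ℤ) + 2) * ((d : ℤ) - 1) ≤ 2 * b) :
    boxCount d (r + 2) (b + 1) < boxCount d (r + 2) b := by
  rw [← boxCount_symm d (r + 2) b, ← boxCount_symm d (r + 2) (b + 1), ← sub_sub]
  push_cast
  exact boxCount_sub_one_lt d r hd _ (by linarith) (by linarith)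

/-! ### The monomial complete intersection and its Hilbert function. -/

open MvPolynomial in
/-- The ideal generated by the `d`-th powers of the variables. -/
noncomputable def purePowers (k : Type*) [Field k] (d r : ℕ) : Ideal (MvPolynomial (Fin r) k) :=
  Ideal.span (Set.range fun i => (X i) ^ d)

section

open MvPolynomial

variable {k : Type*} [Field k]

theorem mem_purePowers_iff {d r : ℕ} {f : MvPolynomial (Fin r) k} :
    f ∈ purePowers k d r ↔ ∀ a : Fin r →₀ ℕ, (∀ i, a i < d) → coeff a f = 0 := by
  have : (Set.range fun i : Fin r => (X i : MvPolynomial (Fin r) k) ^ d) =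
      (fun s => monomial s (1 : k)) '' Set.range fun i : Fin r => Finsupp.single i d := by
    rw [← Set.range_comp]
    simp [Function.comp_def, X_pow_eq_monomial]
  rw [purePowers, this, mem_ideal_span_monomial_image]
  simp only [Set.exists_range_iff, Finsupp.single_le_iff, mem_support_iff]
  refine forall_congr' fun a => ?_
  rw [not_imp_comm]
  simp

instance {n : ℕ} (I : Ideal (MvPolynomial (Fin n) k)) (j : ℕ) :
    Module.Finite k (gradedPart I j) :=
  Module.Finite.iff_fg.2 ((homogeneousSubmodule_fg (R := k) (σ := Fin n) j).map _)

theorem finrank_gradedPart_purePowers (d r j : ℕ) :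
    Module.finrank k (gradedPart (purePowers k d r) j) = boxCount d r j := by
  let B := {a : Fin r → Fin d // ∑ i, ((a i : ℕ) : ℤ) = j}
  let e : B → (Fin r →₀ ℕ) := fun a => Finsupp.equivFunOnFinite.symm fun i => (a.1 i : ℕ)
  have he (a : B) (i : Fin r) : e a i = a.1 i := rfl
  have he_inj : Function.Injective e := fun a b h => by
    ext i
    rw [← he, ← he, h]
  have he_deg (a : B) : (e a).degree = j := by
    have := a.2
    rw [Finsupp.degree_eq_sum]
    simp only [he]
    exact_mod_cast this
  let g : MvPolynomial (Fin r) k →ₗ[k] (B → k) := LinearMap.pi fun a => lcoeff k (e a)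
  have hg (f : MvPolynomial (Fin r) k) (a : B) : g f a = coeff (e a) f := rfl
  let W := homogeneousSubmodule (Fin r) k j
  let q := (Ideal.Quotient.mkₐ k (purePowers k d r)).toLinearMap
  -- On forms of degree j, the quotient map and the list of coefficients inside the box have the
  -- same kernel, hence ranges of equal dimension.
  have hker : LinearMap.ker (q.domRestrict W) = LinearMap.ker (g.domRestrict W) := by
    ext ⟨f, hf⟩
    have hq : q f = 0 ↔ f ∈ purePowers k d r := Ideal.Quotient.eq_zero_iff_mem
    simp only [LinearMap.mem_ker, LinearMap.domRestrict_apply, hq, mem_purePowers_iff]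
    constructor
    · intro h
      ext a
      exact h _ fun i => (a.1 i).2
    · intro h a ha
      by_cases hdeg : a.degree = j
      · have hs : ∑ i, ((⟨a i, ha i⟩ : Fin d) : ℤ) = j := by
          rw [Finsupp.degree_eq_sum] at hdeg
          exact_mod_cast hdeg
        have := congrFun h ⟨fun i => ⟨a i, ha i⟩, hs⟩
        rw [hg, Pi.zero_apply] at this
        convert this
        ext i
        rfl
      · exact IsHomogeneous.coeff_eq_zero hf hdeg
  have hsurj : LinearMap.range (g.domRestrict W) = ⊤ := by
    rw [LinearMap.range_eq_top]
    intro v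
    refine ⟨⟨∑ a : B, monomial (e a) (v a), ?_⟩, ?_⟩
    · exact Submodule.sum_mem _ fun a _ => isHomogeneous_monomial _ (he_deg a)
    · ext b
      simp [hg, coeff_sum, coeff_monomial, he_inj.eq_iff]
  have h1 : gradedPart (purePowers k d r) j = LinearMap.range (q.domRestrict W) := by
    rw [LinearMap.range_domRestrict]
    rfl
  rw [h1, ← (LinearMap.quotKerEquivRange _).finrank_eq, hker,
    (LinearMap.quotKerEquivRange _).finrank_eq, hsurj, finrank_top, Module.finrank_pi]
  rfl

/-! ### Full rank expressed through polynomial representatives. -/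

theorem mk_mem_gradedPart {n : ℕ} (I : Ideal (MvPolynomial (Fin n) k)) {j : ℕ}
    {f : MvPolynomial (Fin n) k} (hf : f.IsHomogeneous j) :
    Ideal.Quotient.mk I f ∈ gradedPart I j := ⟨f, hf, rfl⟩

/-- Multiplication by a linear form on a graded part is injective or surjective if it has full
rank. -/
theorem HasFullRank.injective_or_surjective {V W : Type*} [AddCommGroup V] [Module k V]
    [AddCommGroup W] [Module k W] [Module.Finite k V] [Module.Finite k W] {f : V →ₗ[k] W}
    (h : HasFullRank f) : Function.Injective f ∨ Function.Surjective f := by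
  unfold HasFullRank at h
  rcases le_total (Module.finrank k V) (Module.finrank k W) with hle | hle
  · left
    rw [min_eq_left hle] at h
    have := LinearMap.finrank_range_add_finrank_ker f
    rw [← LinearMap.ker_eq_bot, ← Submodule.finrank_eq_zero (R := k)]
    omega
  · right
    rw [min_eq_right hle] at h
    rw [← LinearMap.range_eq_top]
    exact Submodule.eq_top_of_finrank_eq h

theorem exists_mul_mem_of_finrank_lt {n : ℕ} {I : Ideal (MvPolynomial (Fin n) k)} {j : ℕ}
    (h : Module.finrank k (gradedPart I (j + 1)) < Module.finrank k (gradedPart I j))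
    {L : MvPolynomial (Fin n) k} (hL : L.IsHomogeneous 1) :
    ∃ g : MvPolynomial (Fin n) k, g.IsHomogeneous j ∧ g ∉ I ∧ L * g ∈ I := by
  have hk := LinearMap.ker_ne_bot_of_finrank_lt
    (f := mulLinearForm I ⟨_, mk_mem_gradedPart I hL⟩ j) h
  obtain ⟨⟨_, g, hg, rfl⟩, hx, hx0⟩ := Submodule.exists_mem_ne_zero_of_ne_bot hk
  refine ⟨g, hg, fun hgI => hx0 (Subtype.ext (Ideal.Quotient.eq_zero_iff_mem.2 hgI)), ?_⟩
  have := congrArg Subtype.val (LinearMap.mem_ker.1 hx)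
  rw [← Ideal.Quotient.eq_zero_iff_mem, map_mul]
  exact this

theorem exists_sub_mul_notMem_of_finrank_lt {n : ℕ} {I : Ideal (MvPolynomial (Fin n) k)} {j : ℕ}
    (h : Module.finrank k (gradedPart I j) < Module.finrank k (gradedPart I (j + 1)))
    {L : MvPolynomial (Fin n) k} (hL : L.IsHomogeneous 1) :
    ∃ g : MvPolynomial (Fin n) k, g.IsHomogeneous (j + 1) ∧
      ∀ f : MvPolynomial (Fin n) k, f.IsHomogeneous j → g - L * f ∉ I := by
  by_contra! hc
  refine h.not_ge (LinearMap.finrank_le_finrank_of_surjective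
    (f := mulLinearForm I ⟨_, mk_mem_gradedPart I hL⟩ j) ?_)
  rintro ⟨_, g, hg, rfl⟩
  obtain ⟨f, hf, hfg⟩ := hc g hg
  refine ⟨⟨_, mk_mem_gradedPart I hf⟩, Subtype.ext ?_⟩
  have := Ideal.Quotient.eq.2 hfg
  rw [map_mul] at this
  exact this.symm

theorem HasWLP.exists_linear {n : ℕ} {I : Ideal (MvPolynomial (Fin n) k)} (h : HasWLP I) :
    ∃ L : MvPolynomial (Fin n) k, L.IsHomogeneous 1 ∧ ∀ j : ℕ,
      (∀ g : MvPolynomial (Fin n) k, g.IsHomogeneous j → L * g ∈ I → g ∈ I) ∨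
      ∀ g : MvPolynomial (Fin n) k, g.IsHomogeneous (j + 1) →
        ∃ f : MvPolynomial (Fin n) k, f.IsHomogeneous j ∧ g - L * f ∈ I := by
  obtain ⟨⟨_, L, hL, rfl⟩, h⟩ := h
  refine ⟨L, hL, fun j => (h j).injective_or_surjective.imp (fun hj g hg hgI => ?_)
    fun hj g hg => ?_⟩
  · have h0 : mulLinearForm I ⟨_, L, hL, rfl⟩ j ⟨_, mk_mem_gradedPart I hg⟩ = 0 :=
      Subtype.ext (by
        have := Ideal.Quotient.eq_zero_iff_mem.2 hgI
        rw [map_mul] at this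
        exact this)
    have := congrArg Subtype.val ((map_eq_zero_iff _ hj).1 h0)
    exact Ideal.Quotient.eq_zero_iff_mem.1 this
  · obtain ⟨⟨_, f, hf, rfl⟩, hfg⟩ := hj ⟨_, mk_mem_gradedPart I hg⟩
    refine ⟨f, hf, Ideal.Quotient.eq.1 ?_⟩
    rw [map_mul]
    exact (congrArg Subtype.val hfg).symm

end

/-! ### The ideal of the theorem in closed form. -/

section

open MvPolynomial

variable {k : Type*} [Field k]

/-- The ideal `(x_0, x_1)^d + (x_2^d, …, x_{m+1}^d)`. -/
noncomputable def pairPowIdeal (k : Type*) [Field k] (d m : ℕ) :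
    Ideal (MvPolynomial (Fin (m + 2)) k) :=
  Ideal.span {X 0, X 1} ^ d + Ideal.span {f | ∃ i : Fin (m + 2), 2 ≤ (i : ℕ) ∧ f = X i ^ d}

theorem Ideal.span_pair_pow_le {R : Type*} [CommRing R] {x y : R} {d : ℕ} {I : Ideal R}
    (h : ∀ a b : ℕ, a + b = d → x ^ a * y ^ b ∈ I) : Ideal.span {x, y} ^ d ≤ I := by
  rw [Ideal.span_insert, ← Ideal.add_eq_sup, add_pow, Ideal.sum_eq_sup]
  refine Finset.sup_le fun a ha => Ideal.mul_le_left.trans ?_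
  rw [Ideal.span_singleton_pow, Ideal.span_singleton_pow, Ideal.span_singleton_mul_span_singleton,
    Ideal.span_singleton_le_iff_mem]
  exact h _ _ (by have := Finset.mem_range.1 ha; omega)

theorem span_add_RLex_eq_pairPowIdeal {m d : ℕ} (hd : 1 ≤ d) :
    Ideal.span (Set.range fun i : Fin (m + 2) => (X i : MvPolynomial (Fin (m + 2)) k) ^ d)
      + RLex k (Finsupp.single (0 : Fin (m + 2)) 1 + Finsupp.single (1 : Fin (m + 2)) (d - 1)) =
    pairPowIdeal k d m := by
  have mem0 : (X 0 : MvPolynomial (Fin (m + 2)) k) ∈ Ideal.span {X 0, X 1} :=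
    Ideal.subset_span (by simp)
  have mem1 : (X 1 : MvPolynomial (Fin (m + 2)) k) ∈
      Ideal.span {X 0, (X 1 : MvPolynomial (Fin (m + 2)) k)} :=
    Ideal.subset_span (by simp)
  have hdeg (a : Fin (m + 2) →₀ ℕ) :
      a.degree = a 0 + (a 1 + ∑ i : Fin m, a i.succ.succ) := by
    rw [Finsupp.degree_eq_sum, Fin.sum_univ_succ, Fin.sum_univ_succ]
    rfl
  apply le_antisymm
  · refine sup_le (Ideal.span_le.2 ?_) (Ideal.span_le.2 ?_)
    · rintro _ ⟨i, rfl⟩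
      by_cases hi : 2 ≤ (i : ℕ)
      · exact Ideal.mem_sup_right (Ideal.subset_span ⟨i, hi, rfl⟩)
      · refine Ideal.mem_sup_left (Ideal.pow_mem_pow ?_ d)
        have : i = 0 ∨ i = 1 := by
          rcases i with ⟨i, hi'⟩
          simp only [Fin.ext_iff, Fin.val_zero, Fin.val_one] at *
          omega
        rcases this with rfl | rfl
        exacts [mem0, mem1]
    · rintro _ ⟨a, ha, rfl⟩
      refine Ideal.mem_sup_left ?_
      have ha2 : (∀ i : Fin m, a i.succ.succ = 0) ∧ a 0 + a 1 = d := by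
        have hz : ∀ i : Fin m, a i.succ.succ = 0 := by
          intro i
          have h0 : (Finsupp.single 0 1 + Finsupp.single 1 (d - 1) : Fin (m + 2) →₀ ℕ)
              i.succ.succ = 0 := by
            simp [Fin.ext_iff]
          rcases ha with rfl | ⟨_, t, ht, htj⟩
          · exact h0
          · rw [← h0]
            refine htj _ ?_
            -- A deciding index beyond the first two would need an exponent below 0.
            by_contra hti
            have : 2 ≤ (t : ℕ) := by
              have := Fin.le_def.1 (not_lt.1 hti)
              simp only [Fin.val_succ] at this
              omega
            have : (Finsupp.single 0 1 + Finsupp.single 1 (d - 1) : Fin (m + 2) →₀ ℕ) t = 0 := by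
              have h0 : t ≠ 0 := by rintro rfl; simp at this
              have h1 : t ≠ 1 := by rintro rfl; simp at this
              rw [Finsupp.add_apply, Finsupp.single_eq_of_ne h0, Finsupp.single_eq_of_ne h1, add_zero]
            omega
        refine ⟨hz, ?_⟩
        have e : a.degree = d := by
          have e' : (Finsupp.single (0 : Fin (m + 2)) 1 +
              Finsupp.single (1 : Fin (m + 2)) (d - 1)).degree = d := by
            rw [map_add, Finsupp.degree_single, Finsupp.degree_single]
            omega
          rcases ha with rfl | ⟨h, _⟩
          exacts [e', h.trans e']
        rw [hdeg] at e
        simpa [hz] using e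
      have hm : (monomial a (1 : k)) = X 0 ^ a 0 * X 1 ^ a 1 := by
        rw [monomial_eq, C_1, one_mul, Finsupp.prod_fintype _ _ (by simp), Fin.prod_univ_succ,
          Fin.prod_univ_succ]
        simp [ha2.1]
      rw [hm, ← ha2.2, pow_add]
      exact Ideal.mul_mem_mul (Ideal.pow_mem_pow mem0 _) (Ideal.pow_mem_pow mem1 _)
  · refine sup_le (Ideal.span_pair_pow_le fun a b hab => ?_) (Ideal.span_le.2 ?_)
    · rcases Nat.eq_zero_or_pos a with rfl | ha
      -- x₂^d is smaller than x₁x₂^(d-1), so it has to come from the pure powers.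
      · refine Ideal.mem_sup_left (Ideal.subset_span ⟨1, ?_⟩)
        simp [← hab]
      · refine Ideal.mem_sup_right (Ideal.subset_span
          ⟨Finsupp.single 0 a + Finsupp.single 1 b, ?_, ?_⟩)
        · rcases eq_or_ne a 1 with rfl | ha1
          · left
            rw [← hab, Nat.add_sub_cancel_left]
          · right
            refine ⟨?_, 1, ?_, ?_⟩
            · simp only [map_add, Finsupp.degree_single]
              omega
            · simp
              omega
            · intro j hj
              have hj0 : j ≠ 0 := fun h => by subst h; simp at hj
              simp [Finsupp.single_eq_of_ne hj0, Finsupp.single_eq_of_ne hj.ne']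
        · rw [X_pow_eq_monomial, X_pow_eq_monomial, monomial_mul, one_mul]
    · rintro _ ⟨i, -, rfl⟩
      exact Ideal.mem_sup_left (Ideal.subset_span ⟨i, rfl⟩)

/-! ### Merging and collapsing the first two variables. -/

/-- The homomorphism `x_0 ↦ q₀ x_0 + q₁ x_1`, `x_{i+1} ↦ x_{i+2}`. -/
noncomputable def embedPair {m : ℕ} (q₀ q₁ : k) :
    MvPolynomial (Fin (m + 1)) k →ₐ[k] MvPolynomial (Fin (m + 2)) k :=
  aeval (Fin.cons (C q₀ * X 0 + C q₁ * X 1) fun i : Fin m => X i.succ.succ)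

/-- The homomorphism `x_0 ↦ p₀ x_0`, `x_1 ↦ p₁ x_0`, `x_{i+2} ↦ x_{i+1}`. -/
noncomputable def collapsePair {m : ℕ} (p₀ p₁ : k) :
    MvPolynomial (Fin (m + 2)) k →ₐ[k] MvPolynomial (Fin (m + 1)) k :=
  aeval (Fin.cons (C p₀ * X 0) (Fin.cons (C p₁ * X 0) fun i : Fin m => X i.succ))

section

variable {m : ℕ}

@[simp] theorem embedPair_X_zero (q₀ q₁ : k) :
    embedPair (m := m) q₀ q₁ (X 0) = C q₀ * X 0 + C q₁ * X 1 := by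
  simp [embedPair]

@[simp] theorem embedPair_X_succ (q₀ q₁ : k) (i : Fin m) :
    embedPair q₀ q₁ (X i.succ) = X i.succ.succ := by
  simp [embedPair]

@[simp] theorem collapsePair_X_zero (p₀ p₁ : k) :
    collapsePair (m := m) p₀ p₁ (X 0) = C p₀ * X 0 := by
  simp [collapsePair]

@[simp] theorem collapsePair_X_one (p₀ p₁ : k) :
    collapsePair (m := m) p₀ p₁ (X 1) = C p₁ * X 0 := by
  rw [collapsePair, aeval_X, show (1 : Fin (m + 2)) = Fin.succ 0 from rfl, Fin.cons_succ,
    Fin.cons_zero]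

@[simp] theorem collapsePair_X_succ_succ (p₀ p₁ : k) (i : Fin m) :
    collapsePair p₀ p₁ (X i.succ.succ) = X i.succ := by
  simp [collapsePair]

theorem collapsePair_embedPair {p₀ p₁ q₀ q₁ : k} (h : q₀ * p₀ + q₁ * p₁ = 1)
    (f : MvPolynomial (Fin (m + 1)) k) : collapsePair p₀ p₁ (embedPair q₀ q₁ f) = f := by
  have : (collapsePair p₀ p₁).comp (embedPair q₀ q₁) =
      AlgHom.id k (MvPolynomial (Fin (m + 1)) k) := by
    ext1 i
    refine Fin.cases ?_ (fun i => ?_) i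
    · simp only [AlgHom.comp_apply, embedPair_X_zero, map_add, map_mul, algHom_C, algebraMap_eq,
        collapsePair_X_zero, collapsePair_X_one, AlgHom.id_apply]
      rw [← mul_assoc, ← mul_assoc, ← add_mul, ← C_mul, ← C_mul, ← C_add, h, C_1, one_mul]
    · simp
  exact DFunLike.congr_fun this f

theorem embedPair_isHomogeneous (q₀ q₁ : k) {f : MvPolynomial (Fin (m + 1)) k} {j : ℕ}
    (hf : f.IsHomogeneous j) : (embedPair q₀ q₁ f).IsHomogeneous j := by
  have := hf.aeval (n := 1) (Fin.cons (C q₀ * X 0 + C q₁ * X 1) fun i : Fin m => X i.succ.succ)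
    (fun i => ?_)
  · rwa [one_mul] at this
  · refine Fin.cases ?_ (fun i => ?_) i
    · exact (isHomogeneous_C_mul_X _ _).add (isHomogeneous_C_mul_X _ _)
    · exact isHomogeneous_X _ _

theorem collapsePair_isHomogeneous (p₀ p₁ : k) {f : MvPolynomial (Fin (m + 2)) k} {j : ℕ}
    (hf : f.IsHomogeneous j) : (collapsePair p₀ p₁ f).IsHomogeneous j := by
  have := hf.aeval (n := 1)
    (Fin.cons (C p₀ * X 0) (Fin.cons (C p₁ * X 0) fun i : Fin m => X i.succ)) (fun i => ?_)
  · rwa [one_mul] at this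
  · refine Fin.cases ?_ (fun i => Fin.cases ?_ (fun i => ?_) i) i
    · exact isHomogeneous_C_mul_X _ _
    · exact isHomogeneous_C_mul_X _ _
    · exact isHomogeneous_X _ _

theorem embedPair_mem (q₀ q₁ : k) {d : ℕ} {f : MvPolynomial (Fin (m + 1)) k}
    (hf : f ∈ purePowers k d (m + 1)) : embedPair q₀ q₁ f ∈ pairPowIdeal k d m := by
  suffices purePowers k d (m + 1) ≤ (pairPowIdeal k d m).comap (embedPair q₀ q₁) from this hf
  refine Ideal.span_le.2 ?_
  rintro _ ⟨i, rfl⟩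
  simp only [SetLike.mem_coe, Ideal.mem_comap, map_pow]
  refine Fin.cases ?_ (fun i => ?_) i
  · rw [embedPair_X_zero]
    exact Ideal.mem_sup_left (Ideal.pow_mem_pow (Ideal.add_mem _
      (Ideal.mul_mem_left _ _ (Ideal.subset_span (by simp)))
      (Ideal.mul_mem_left _ _ (Ideal.subset_span (by simp)))) d)
  · rw [embedPair_X_succ]
    exact Ideal.mem_sup_right (Ideal.subset_span ⟨_, by simp, rfl⟩)

theorem exists_eq_succ_succ {i : Fin (m + 2)} (hi : 2 ≤ (i : ℕ)) : ∃ t : Fin m, i = t.succ.succ :=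
  ⟨⟨i - 2, by omega⟩, by ext; simp; omega⟩

theorem collapsePair_mem (p₀ p₁ : k) {d : ℕ} {f : MvPolynomial (Fin (m + 2)) k}
    (hf : f ∈ pairPowIdeal k d m) : collapsePair p₀ p₁ f ∈ purePowers k d (m + 1) := by
  suffices pairPowIdeal k d m ≤ (purePowers k d (m + 1)).comap (collapsePair p₀ p₁) from this hf
  have hX (i : Fin (m + 1)) : (X i : MvPolynomial (Fin (m + 1)) k) ^ d ∈ purePowers k d (m + 1) :=
    Ideal.subset_span ⟨i, rfl⟩
  refine sup_le (Ideal.span_pair_pow_le fun a b hab => ?_) (Ideal.span_le.2 ?_)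
  · have : collapsePair p₀ p₁ (X 0 ^ a * X 1 ^ b : MvPolynomial (Fin (m + 2)) k) =
        (C p₀ ^ a * C p₁ ^ b) * X 0 ^ d := by
      simp only [map_mul, map_pow, collapsePair_X_zero, collapsePair_X_one, ← hab]
      ring
    rw [Ideal.mem_comap, this]
    exact Ideal.mul_mem_left _ _ (hX 0)
  · rintro _ ⟨i, hi, rfl⟩
    obtain ⟨t, rfl⟩ := exists_eq_succ_succ hi
    simp only [SetLike.mem_coe, Ideal.mem_comap, map_pow, collapsePair_X_succ_succ]
    exact hX _

theorem exists_eq_sum_C_mul_X {n : ℕ} {L : MvPolynomial (Fin n) k} (hL : L.IsHomogeneous 1) :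
    ∃ c : Fin n → k, L = ∑ i, C (c i) * X i := by
  have h : L ∈ homogeneousSubmodule (Fin n) k 1 := hL
  rw [homogeneousSubmodule_one_eq_span_X, Submodule.mem_span_range_iff_exists_fun] at h
  obtain ⟨c, rfl⟩ := h
  exact ⟨c, by simp [smul_eq_C_mul]⟩

theorem isHomogeneous_sum_C_mul_X {n : ℕ} (c : Fin n → k) :
    (∑ i, C (c i) * X i : MvPolynomial (Fin n) k).IsHomogeneous 1 :=
  IsHomogeneous.sum _ _ _ fun _ _ => isHomogeneous_C_mul_X _ _

theorem exists_mul_eq_of_pair (c₀ c₁ : k) :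
    ∃ s q₀ q₁ p₀ p₁ : k, c₀ = s * q₀ ∧ c₁ = s * q₁ ∧ q₀ * p₀ + q₁ * p₁ = 1 := by
  by_cases h0 : c₀ = 0
  · by_cases h1 : c₁ = 0
    -- If both coefficients vanish, the scalar s absorbs this, so q stays nonzero and the retraction
    -- still exists.
    · exact ⟨0, 1, 0, 1, 0, by simp [h0], by simp [h1], by simp⟩
    · exact ⟨1, c₀, c₁, 0, c₁⁻¹, by simp, by simp, by simp [h1]⟩
  · exact ⟨1, c₀, c₁, c₀⁻¹, 0, by simp, by simp, by simp [h0]⟩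

theorem exists_isotropic_pair (c₀ c₁ : k) :
    ∃ q₀ q₁ p₀ p₁ : k, c₀ * p₀ + c₁ * p₁ = 0 ∧ q₀ * p₀ + q₁ * p₁ = 1 := by
  by_cases h0 : c₀ = 0
  · exact ⟨1, 0, 1, 0, by simp [h0], by simp⟩
  · exact ⟨0, 1, -c₁ / c₀, 1, by field_simp; ring, by simp⟩

/-! ### Obstructions to injectivity and surjectivity. -/

theorem pairPowIdeal_exists_kernel {d j : ℕ}
    (h : boxCount d (m + 1) (j + 1 : ℕ) < boxCount d (m + 1) j)
    {L : MvPolynomial (Fin (m + 2)) k} (hL : L.IsHomogeneous 1) :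
    ∃ g : MvPolynomial (Fin (m + 2)) k, g.IsHomogeneous j ∧ g ∉ pairPowIdeal k d m ∧
      L * g ∈ pairPowIdeal k d m := by
  obtain ⟨c, rfl⟩ := exists_eq_sum_C_mul_X hL
  obtain ⟨s, q₀, q₁, p₀, p₁, h0, h1, hpq⟩ := exists_mul_eq_of_pair (c 0) (c 1)
  let b : Fin (m + 1) → k := Fin.cons s fun i => c i.succ.succ
  have hb : embedPair q₀ q₁ (∑ i, C (b i) * X i) = ∑ i, C (c i) * X i := by
    rw [Fin.sum_univ_succ, Fin.sum_univ_succ, Fin.sum_univ_succ]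
    simp only [b, Fin.cons_zero, Fin.cons_succ, map_add, map_sum, map_mul, algHom_C, algebraMap_eq,
      embedPair_X_zero, embedPair_X_succ, h0, h1, Fin.succ_zero_eq_one]
    ring
  rw [← finrank_gradedPart_purePowers (k := k), ← finrank_gradedPart_purePowers (k := k)] at h
  obtain ⟨g, hg, hgJ, hmul⟩ := exists_mul_mem_of_finrank_lt h (isHomogeneous_sum_C_mul_X b)
  refine ⟨embedPair q₀ q₁ g, embedPair_isHomogeneous _ _ hg, fun hK => hgJ ?_, ?_⟩
  · rw [← collapsePair_embedPair hpq g]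
    exact collapsePair_mem _ _ hK
  · rw [← hb, ← map_mul]
    exact embedPair_mem _ _ hmul

/-- Below degree d in the first variable, its d-th power contributes nothing. -/
theorem coeff_finSuccEquiv_mem {d i : ℕ} (hi : i < d) {f : MvPolynomial (Fin (m + 1)) k}
    (hf : f ∈ purePowers k d (m + 1)) :
    (finSuccEquiv k m f).coeff i ∈ purePowers k d m := by
  rw [mem_purePowers_iff] at hf ⊢
  intro a ha
  rw [finSuccEquiv_coeff_coeff]
  refine hf _ fun t => ?_
  refine Fin.cases ?_ (fun t => ?_) t
  · simpa using hi
  · simpa using ha t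

theorem finSuccEquiv_rename_succ (g : MvPolynomial (Fin m) k) :
    finSuccEquiv k m (rename Fin.succ g) = Polynomial.C g := by
  induction g using MvPolynomial.induction_on with
  | C a => simp [finSuccEquiv_apply]
  | add p q hp hq => simp [hp, hq]
  | mul_X p i hp => simp [hp, finSuccEquiv_X_succ]

theorem pairPowIdeal_exists_notMem_range {d e : ℕ} (hd : 1 ≤ d)
    (h : boxCount d m e < boxCount d m (e + 1 : ℕ))
    {L : MvPolynomial (Fin (m + 2)) k} (hL : L.IsHomogeneous 1) :
    ∃ g : MvPolynomial (Fin (m + 2)) k, g.IsHomogeneous (e + (d - 1) + 1) ∧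
      ∀ f : MvPolynomial (Fin (m + 2)) k, f.IsHomogeneous (e + (d - 1)) →
        g - L * f ∉ pairPowIdeal k d m := by
  obtain ⟨c, rfl⟩ := exists_eq_sum_C_mul_X hL
  obtain ⟨q₀, q₁, p₀, p₁, hcp, hpq⟩ := exists_isotropic_pair (c 0) (c 1)
  rw [← finrank_gradedPart_purePowers (k := k), ← finrank_gradedPart_purePowers (k := k)] at h
  obtain ⟨g, hg, hgJ⟩ := exists_sub_mul_notMem_of_finrank_lt h
    (isHomogeneous_sum_C_mul_X fun i : Fin m => c i.succ.succ)
  have hL' : finSuccEquiv k m (collapsePair p₀ p₁ (∑ i, C (c i) * X i)) =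
      Polynomial.C (∑ i : Fin m, C (c i.succ.succ) * X i) := by
    have : collapsePair p₀ p₁ (∑ i, C (c i) * X i) =
        ∑ i : Fin m, C (c i.succ.succ) * X i.succ := by
      rw [Fin.sum_univ_succ, Fin.sum_univ_succ]
      simp only [map_add, map_sum, map_mul, algHom_C, algebraMap_eq, collapsePair_X_zero,
        collapsePair_X_one, collapsePair_X_succ_succ, Fin.succ_zero_eq_one]
      rw [← add_assoc, ← mul_assoc, ← mul_assoc, ← add_mul, ← C_mul, ← C_mul, ← C_add, hcp, C_0,
        zero_mul, zero_add]
    rw [this]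
    simp [finSuccEquiv_apply]
  -- The witness is a class outside the image on C, placed at the top power y^(d-1).
  refine ⟨embedPair q₀ q₁ (rename Fin.succ g * X 0 ^ (d - 1)), ?_, fun f hf hK => ?_⟩
  · refine embedPair_isHomogeneous _ _ ?_
    rw [add_right_comm]
    exact hg.rename_isHomogeneous.mul (isHomogeneous_X_pow _ _)
  · have := coeff_finSuccEquiv_mem (i := d - 1) (by omega) (collapsePair_mem p₀ p₁ hK)
    rw [map_sub, collapsePair_embedPair hpq, map_mul, map_sub, map_mul, map_mul, hL', map_pow,
      finSuccEquiv_X_zero, finSuccEquiv_rename_succ, Polynomial.coeff_sub,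
      Polynomial.coeff_C_mul] at this
    simp only [Polynomial.coeff_C_mul, Polynomial.coeff_X_pow, if_true, mul_one] at this
    refine hgJ _ ?_ this
    exact (collapsePair_isHomogeneous p₀ p₁ hf).finSuccEquiv_coeff_isHomogeneous _ _ (by omega)

end

theorem not_hasWLP_pairPowIdeal {d m : ℕ} (hm : 2 ≤ m) (hd : 3 ≤ d) :
    ¬ HasWLP (pairPowIdeal k d m) := by
  intro hW
  obtain ⟨L, hL, hWL⟩ := hW.exists_linear
  obtain ⟨r, rfl⟩ := Nat.exists_eq_add_of_le' hm
  obtain ⟨c, rfl⟩ := Nat.exists_eq_add_of_le' (show 1 ≤ d by omega)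
  -- With c = d - 1, the socle degrees of B and C are (r + 3)c and (r + 2)c; the bounds say 2(e + c)
  -- ≥ (r + 3)c and 2(e + 1) ≤ (r + 2)c. The window for 2e has length c - 2: for c ≥ 3 it contains
  -- an even number, and for c = 2 its only point is even.
  obtain ⟨e, he1, he2⟩ : ∃ e : ℕ, (r + 1) * c ≤ 2 * e ∧ 2 * e + 2 ≤ (r + 2) * c := by
    refine ⟨((r + 1) * c + 1) / 2, by omega, ?_⟩
    have : (r + 2) * c = (r + 1) * c + c := by ring
    obtain rfl | hc := (show 2 ≤ c by omega).eq_or_lt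
    all_goals omega
  have hup : (e : ℤ) + 1 ≤ ((r : ℤ) + 2) * c := by
    have : (0 : ℤ) ≤ e := by positivity
    zify at he2
    linarith
  rcases hWL (e + (c + 1 - 1)) with h | h
  · obtain ⟨g, hg, hgK, hLg⟩ := pairPowIdeal_exists_kernel (d := c + 1) (j := e + (c + 1 - 1)) (by
      have := boxCount_add_one_lt (c + 1) (r + 1) (by omega) ((e + (c + 1 - 1) : ℕ) : ℤ) (by
        push_cast; zify at he2; simp; linarith) (by
        push_cast; zify at he1; simp; linarith)
      exact_mod_cast this) hL
    exact hgK (h g hg hLg)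
  · obtain ⟨g, hg, hgK⟩ := pairPowIdeal_exists_notMem_range (d := c + 1) (e := e) (by omega) (by
      have := boxCount_sub_one_lt (c + 1) r (by omega) ((e + 1 : ℕ) : ℤ) (by positivity) (by
        push_cast; zify at he2; simp; linarith)
      simpa using this) hL
    obtain ⟨f, hf, hfK⟩ := h g hg
    exact hgK f hf hfK

end

theorem mainTheorem6 {k : Type*} [Field k] [CharZero k] (n d : ℕ) (hn : 4 ≤ n) (hd : 3 ≤ d)
    (I : Ideal (MvPolynomial (Fin n) k))
    (hI : I = Ideal.span (Set.range fun i : Fin n => (MvPolynomial.X i : MvPolynomial (Fin n) k) ^ d)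
      + RLex k (Finsupp.single (⟨0, by omega⟩ : Fin n) 1
          + Finsupp.single (⟨1, by omega⟩ : Fin n) (d - 1))) :
    I = Ideal.span {MvPolynomial.X (⟨0, by omega⟩ : Fin n),
            MvPolynomial.X (⟨1, by omega⟩ : Fin n)} ^ d
        + Ideal.span {f | ∃ i : Fin n, 2 ≤ (i : ℕ) ∧ f = MvPolynomial.X i ^ d} ∧
      ¬ HasWLP I := by
  obtain ⟨m, rfl⟩ := Nat.exists_eq_add_of_le' (show 2 ≤ n by omega)
  have hK : I = pairPowIdeal k d m := hI.trans (span_add_RLex_eq_pairPowIdeal (by omega))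
  refine ⟨hK, ?_⟩
  rw [hK]
  exact not_hasWLP_pairPowIdeal (by omega) hd
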